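/- Let $A\in\mathbb{R}^{n\times m}$ be a nonzero matrix, let $0<\epsilon<1$, and let $W\in\mathbb{R}^{m\times m}$ be a diagonal matrix all of whose diagonal entries are nonzero. Let $\sigma_i(A)$ denote the singular values of $A$, and set $$\mathrm{srank}_4(A):=\frac{\big(\sum_i\sigma_i(A)^2\big)^2}{\sum_i\sigma_i(A)^4}.$$ Then there exists a subset $S\subseteq\{1,\dots,m\}$ of size $$|S|=\big\lfloor(1-\epsilon)^2\,\mathrm{srank}_4(A)\big\rfloor+1$$ such that $$\sigma_{\min}(A_SW_S)\ \ge\ \epsilon\,\frac{\|A\|_F}{\|W^{-1}\|_F}.$$ Here $A_S\in\mathbb{R}^{n\times|S|}$ is the submatrix of $A$ formed by the columns indexed by $S$, $W_S\in\mathbb{R}^{|S|\times|S|}$ is the submatrix of $W$ formed by the rows and columns indexed by $S$, $\sigma_{\min}(B):=\min_{\|x\|_2=1}\|Bx\|_2$, and $\|\cdot\|_F$ is the Frobenius norm. -/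

import Mathlib

open scoped Matrix.Norms.Frobenius

/-- The least singular value `min_{‖x‖₂ = 1} ‖B x‖₂` of a real matrix, with Euclidean norms on both
sides. (For at least one column the unit sphere is compact and nonempty, so the infimum is
attained.) -/
noncomputable def sigmaMin {ι κ : Type*} [Fintype ι] [Fintype κ] [DecidableEq κ]
    (B : Matrix ι κ ℝ) : ℝ :=
  sInf ((fun x : EuclideanSpace ℝ κ => ‖Matrix.toEuclideanLin B x‖) '' Metric.sphere 0 1)

/-- The Schatten `4`-norm stable rank `(∑ σᵢ²)² / ∑ σᵢ⁴`, where the sums run over the nonzero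
singular values of `A`, listed with multiplicity. -/
noncomputable def srank4 {n m : ℕ} (A : Matrix (Fin n) (Fin m) ℝ) : ℝ :=
  ((Matrix.toEuclideanLin A).singularValues.sum fun _ s => s ^ 2) ^ 2 /
    (Matrix.toEuclideanLin A).singularValues.sum fun _ s => s ^ 4

/-- The submatrix `A_S` of the columns of `A` indexed by `S`. -/
def colSubmatrix {n m : ℕ} (A : Matrix (Fin n) (Fin m) ℝ) (S : Finset (Fin m)) :
    Matrix (Fin n) S ℝ :=
  A.submatrix id Subtype.val

/-- The principal submatrix `W_S` of `W` with rows and columns indexed by `S`. -/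
def principalSubmatrix {m : ℕ} (W : Matrix (Fin m) (Fin m) ℝ) (S : Finset (Fin m)) :
    Matrix S S ℝ :=
  W.submatrix Subtype.val Subtype.val

/-! Choose column `i` with probability proportional to `(W i i)⁻¹ ^ 2` and replace it by `v i = ω *
W i i` times that column, where `ω = ‖W⁻¹‖`. The second moment of one sample is then `A Aᵀ`,
whatever `W` is. Draw `k + 1` independent samples, `k` being the floor in the statement.

The expected characteristic polynomial of their Gram matrix depends only on the eigenvalues `λ` of
`A Aᵀ`: it is `∏ (1 - λ D) X ^ (k + 1)` (`gramAverage_nil`). Each factor `1 - λ D` preserves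
real-rootedness and moves a lower barrier for the roots to the right by an explicit amount
(`HasLowerBarrier.sub_derivative`). Since `∑ λ = ‖A‖²` and `(∑ λ)² / ∑ λ² = srank4 A`, all roots are
at least `ε² ‖A‖²` (`eval_shiftedPow_ne_zero`).

Some outcome does at least as well as the expectation. Samples are fixed one at a time; the
conditional averages, divided by the average with one vector fewer, map the upper half plane to
itself, and the resulting monotonicity lets one choice keep roots out of the region below the bound
(`exists_eval_ne_zero_of_sum`).

A positive least Gram eigenvalue excludes repetitions, so the outcome is a set `S`; dividing by `ω`
gives the bound for `A_S W_S`. -/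

open Polynomial Matrix

/-! ### Real-rooted polynomials and the lower barrier -/

/-- First and second derivatives of a product of linear factors, away from its roots. -/
theorem eval_derivative_prod_X_sub_C {ι K : Type*} [Field K] (s : Finset ι) (r : ι → K) (x : K)
    (hx : ∀ i ∈ s, x ≠ r i) :
    (derivative (∏ i ∈ s, (X - C (r i)))).eval x =
        (∏ i ∈ s, (x - r i)) * ∑ i ∈ s, (x - r i)⁻¹ ∧
      (derivative (derivative (∏ i ∈ s, (X - C (r i))))).eval x =
        (∏ i ∈ s, (x - r i)) *
          ((∑ i ∈ s, (x - r i)⁻¹) ^ 2 - ∑ i ∈ s, ((x - r i)⁻¹) ^ 2) := by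
  classical
  induction s using Finset.induction_on with
  | empty => simp
  | insert a s ha ih =>
    obtain ⟨h1, h2⟩ := ih fun i hi => hx i (Finset.mem_insert_of_mem hi)
    have hne : x - r a ≠ 0 := sub_ne_zero.2 (hx a (Finset.mem_insert_self _ _))
    have hev : (∏ i ∈ s, (X - C (r i))).eval x = ∏ i ∈ s, (x - r i) := by
      simp [eval_prod]
    simp only [Finset.prod_insert ha, Finset.sum_insert ha, derivative_mul, derivative_sub,
      derivative_X, derivative_C, sub_zero, one_mul, derivative_add, eval_add, eval_mul, eval_sub,
      eval_X, eval_C, h1, h2, hev]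
    constructor
    · field_simp
    · field_simp; ring

/-- A monic real polynomial without zeros in the open upper half plane is a product of real linear
factors. -/
theorem exists_prod_X_sub_C_of_ne_zero_of_im_pos {p : ℝ[X]} {k : ℕ} (hp : p.Monic)
    (hk : p.natDegree = k) (h : ∀ z : ℂ, 0 < z.im → aeval z p ≠ 0) :
    ∃ r : Fin k → ℝ, p = ∏ i, (X - C (r i)) := by
  have hs : p.Splits := by
    refine (IsAlgClosed.splits (p.map (algebraMap ℝ ℂ))).of_splits_map (algebraMap ℝ ℂ) ?_
    intro z hz
    have hz0 : aeval z p = 0 := by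
      have := (mem_roots'.1 hz).2
      rwa [IsRoot, eval_map_algebraMap] at this
    rcases lt_trichotomy z.im 0 with hlt | heq | hgt
    · refine absurd ?_ (h (starRingEnd ℂ z) (by simpa using hlt))
      rw [aeval_conj, hz0, map_zero]
    · exact ⟨z.re, by apply Complex.ext <;> simp [heq]⟩
    · exact absurd hz0 (h z hgt)
  obtain ⟨l, hl⟩ := Quot.exists_rep p.roots
  have hl' : p.roots = (l : Multiset ℝ) := hl.symm
  have hlen : l.length = k := by rw [← hk, hs.natDegree_eq_card_roots, hl', Multiset.coe_card]
  subst hlen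
  refine ⟨fun i => l[i], ?_⟩
  rw [hs.eq_prod_roots_of_monic hp, hl', Multiset.map_coe, Multiset.prod_coe]
  exact (Fin.prod_univ_fun_getElem l fun a => X - C a).symm

/-- A zero in the upper half plane would give `lam * (p' / p) = 1`, but there `p' / p = ∑ (z -
rᵢ)⁻¹` has negative imaginary part for `k > 0`. This forces `lam = 0`, which is absurd. -/
theorem exists_prod_X_sub_C_sub_derivative {k : ℕ} (r : Fin k → ℝ) (lam : ℝ) :
    ∃ r' : Fin k → ℝ, (∏ i, (X - C (r i))) - C lam * derivative (∏ i, (X - C (r i))) =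
      ∏ i, (X - C (r' i)) := by
  set p : ℝ[X] := ∏ i, (X - C (r i)) with hp
  have hpm : p.Monic := monic_prod_of_monic _ _ fun i _ => monic_X_sub_C _
  have hdeg : p.natDegree = k := by simp [hp]
  rcases Nat.eq_zero_or_pos k with rfl | hk
  · exact ⟨r, by simp [hp]⟩
  have hlt : (C lam * derivative p).degree < p.degree :=
    by
    rw [← smul_eq_C_mul]
    exact (degree_smul_le lam _).trans_lt (degree_derivative_lt hpm.ne_zero)
  have hqm : (p - C lam * derivative p).Monic := hpm.sub_of_left hlt
  have hqd : (p - C lam * derivative p).natDegree = k := by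
    rw [← hdeg]; exact natDegree_eq_of_degree_eq (degree_sub_eq_left_of_degree_lt hlt)
  refine exists_prod_X_sub_C_of_ne_zero_of_im_pos hqm hqd ?_
  intro z hz h0
  have hzr : ∀ i ∈ (Finset.univ : Finset (Fin k)), z ≠ ((r i : ℝ) : ℂ) := by
    rintro i - rfl; simp at hz
  have hmap : p.map (algebraMap ℝ ℂ) = ∏ i, (X - C ((r i : ℝ) : ℂ)) := by
    simp [hp, Polynomial.map_prod]
  have hd := (eval_derivative_prod_X_sub_C Finset.univ (fun i => ((r i : ℝ) : ℂ)) z hzr).1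
  have hne : ∏ i, (z - ((r i : ℝ) : ℂ)) ≠ 0 :=
    Finset.prod_ne_zero_iff.2 fun i hi => sub_ne_zero.2 (hzr i hi)
  have h1 : (1 : ℂ) - lam * ∑ i, (z - ((r i : ℝ) : ℂ))⁻¹ = 0 := by
    rw [← eval_map_algebraMap, Polynomial.map_sub, Polynomial.map_mul, ← derivative_map, hmap,
      eval_sub, eval_mul, hd, eval_prod] at h0
    simp only [eval_sub, eval_X, eval_C, map_C, Complex.coe_algebraMap] at h0
    apply mul_left_cancel₀ hne
    linear_combination h0
  have h2 := congrArg Complex.im h1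
  have hneg : (∑ i, (z - ((r i : ℝ) : ℂ))⁻¹).im < 0 := by
    rw [Complex.im_sum]
    have : Nonempty (Fin k) := ⟨⟨0, hk⟩⟩
    apply Finset.sum_neg
    · intro i _
      rw [Complex.inv_im]
      have : 0 < Complex.normSq (z - r i) := Complex.normSq_pos.2 (sub_ne_zero.2 (hzr i (Finset.mem_univ i)))
      simp only [Complex.sub_im, Complex.ofReal_im, sub_zero]
      exact div_neg_of_neg_of_pos (by linarith) this
    · exact Finset.univ_nonempty
  simp only [Complex.sub_im, Complex.one_im, Complex.im_ofReal_mul,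
    Complex.zero_im] at h2
  have hl : lam = 0 := by
    rcases mul_eq_zero.1 (by linarith : lam * (∑ i, (z - ((r i : ℝ) : ℂ))⁻¹).im = 0) with h | h
    · exact h
    · exact absurd h hneg.ne
  simp [hl] at h1

/-- The numerical inequality behind the shift of the lower barrier. -/
theorem barrier_shift_inequality {ι : Type*} (s : Finset ι) (y : ι → ℝ) (hy : ∀ i ∈ s, 0 < y i)
    {lam α δ : ℝ} (hlam : 0 ≤ lam) (hδ : 0 ≤ δ) (hα : 0 < α) (hδα : δ * (1 + lam * α) = lam)
    (hA : ∑ i ∈ s, (y i + δ)⁻¹ ≤ α) :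
    (∑ i ∈ s, (y i)⁻¹) + lam * ((∑ i ∈ s, (y i)⁻¹) ^ 2 - ∑ i ∈ s, ((y i)⁻¹) ^ 2) ≤
      α * (1 + lam * ∑ i ∈ s, (y i)⁻¹) := by
  set A := ∑ i ∈ s, (y i + δ)⁻¹
  set Φ := ∑ i ∈ s, (y i)⁻¹
  set Φ₂ := ∑ i ∈ s, ((y i)⁻¹) ^ 2
  set S := ∑ i ∈ s, (y i)⁻¹ * (y i + δ)⁻¹ with hS
  set R := ∑ i ∈ s, ((y i)⁻¹) ^ 2 * (y i + δ)⁻¹ with hR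
  -- `y i` is the distance from the shifted barrier to a root and `y i + δ` that from the old one,
  -- so `A` is the old barrier value and `Φ` the value for the same roots at the new point.
  -- Differences of reciprocals produce `S` and `R`, which Cauchy–Schwarz compares.
  have e1 : Φ - A = δ * S := by
    rw [← Finset.sum_sub_distrib, hS, Finset.mul_sum]
    refine Finset.sum_congr rfl fun i hi => ?_
    have := hy i hi
    have : 0 < y i + δ := by linarith
    field_simp; ring
  have e2 : Φ₂ - S = δ * R := by
    rw [← Finset.sum_sub_distrib, hR, Finset.mul_sum]
    refine Finset.sum_congr rfl fun i hi => ?_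
    have := hy i hi
    have : 0 < y i + δ := by linarith
    field_simp; ring
  have cs : S ^ 2 ≤ R * A := by
    apply Finset.sum_sq_le_sum_mul_sum_of_sq_le_mul
    · intro i hi; have := hy i hi; positivity
    · intro i hi; have := hy i hi; positivity
    · exact fun i hi => le_of_eq (by ring)
  have hS0 : 0 ≤ S := Finset.sum_nonneg fun i hi => by have := hy i hi; positivity
  have hR0 : 0 ≤ R := Finset.sum_nonneg fun i hi => by have := hy i hi; positivity
  have hΦ0 : 0 ≤ Φ := Finset.sum_nonneg fun i hi => by have := hy i hi; positivity
  have hA0 : 0 ≤ A := Finset.sum_nonneg fun i hi => by have := hy i hi; positivity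
  have hδα1 : δ * α ≤ 1 := by
    have h1 : δ * α * (1 + lam * α) = lam * α := by linear_combination α * hδα
    have h2 : 0 ≤ lam * α := by positivity
    by_contra hc
    push Not at hc
    nlinarith
  have k1 : δ * S ^ 2 ≤ R := by
    calc δ * S ^ 2 ≤ δ * (R * A) := by gcongr
      _ ≤ δ * (R * α) := by gcongr
      _ = (δ * α) * R := by ring
      _ ≤ 1 * R := by gcongr
      _ = R := one_mul R
  have k2 : (Φ - A) * (1 + lam * Φ) ≤ lam * Φ₂ := by
    have h3 : 1 + lam * Φ ≤ 1 + lam * α + lam * (δ * S) := by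
      rw [← e1]; nlinarith
    calc (Φ - A) * (1 + lam * Φ) ≤ (δ * S) * (1 + lam * α + lam * (δ * S)) := by
          rw [e1]; gcongr
      _ = (δ * (1 + lam * α)) * S + lam * δ * (δ * S ^ 2) := by ring
      _ ≤ lam * S + lam * δ * R := by rw [hδα]; gcongr
      _ = lam * Φ₂ := by linear_combination lam * (-e2)
  have k3 : A * (1 + lam * Φ) ≤ α * (1 + lam * Φ) := by gcongr
  linarith

/-- `p` is a product of `k` real linear factors whose roots lie above `b`, and the lower barrier
function `∑ 1 / (rᵢ - b)` is at most `α`. -/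
def HasLowerBarrier (p : ℝ[X]) (k : ℕ) (b α : ℝ) : Prop :=
  ∃ r : Fin k → ℝ, p = ∏ i, (X - C (r i)) ∧ (∀ i, b < r i) ∧ ∑ i, (r i - b)⁻¹ ≤ α

/-- Left of the roots, `-p' / p` is the barrier function `Φ`, so `p - lam * p' = p * (1 + lam * Φ)`
does not vanish there. Differentiating once more gives the new barrier function as `(Φ + lam * (Φ² -
Φ₂)) / (1 + lam * Φ)`, with `Φ₂` the sum of the squared reciprocals; `barrier_shift_inequality`
bounds it by `α`. -/
theorem HasLowerBarrier.sub_derivative {p : ℝ[X]} {k : ℕ} {b α lam : ℝ}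
    (h : HasLowerBarrier p k b α) (hα : 0 < α) (hlam : 0 ≤ lam) :
    HasLowerBarrier (p - C lam * derivative p) k (b + lam / (1 + lam * α)) α := by
  obtain ⟨r, hp, hb, hsum⟩ := h
  obtain ⟨r', hr'⟩ := exists_prod_X_sub_C_sub_derivative r lam
  have hden : 0 < 1 + lam * α := by positivity
  set δ := lam / (1 + lam * α) with hδdef
  have hδ : 0 ≤ δ := by positivity
  have hδα : δ * (1 + lam * α) = lam := div_mul_cancel₀ _ hden.ne'
  have hδα1 : δ * α < 1 := by
    rw [hδdef, div_mul_eq_mul_div, div_lt_one hden]; linarith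
  have hgap : ∀ i, b + δ < r i := by
    intro i
    have h1 : (r i - b)⁻¹ ≤ α :=
      (Finset.single_le_sum (f := fun i => (r i - b)⁻¹)
        (fun j _ => inv_nonneg.2 (sub_nonneg.2 (hb j).le)) (Finset.mem_univ i)).trans hsum
    have h2 : 0 < r i - b := sub_pos.2 (hb i)
    have h3 : 1 ≤ α * (r i - b) := by
      rwa [inv_le_iff_one_le_mul₀ h2] at h1
    by_contra hc
    push Not at hc
    nlinarith
  have hval : ∀ x, (∀ i, x < r i) → (∏ i, (X - C (r' i))).eval x =
      (∏ i, (x - r i)) * (1 + lam * ∑ i, (r i - x)⁻¹) := by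
    intro x hx
    have hd := (eval_derivative_prod_X_sub_C Finset.univ r x fun i _ => (hx i).ne).1
    rw [← hr', eval_sub, eval_mul, hd, eval_prod]
    have : ∑ i, (x - r i)⁻¹ = -∑ i, (r i - x)⁻¹ := by
      rw [← Finset.sum_neg_distrib]
      exact Finset.sum_congr rfl fun i _ => by rw [← inv_neg, neg_sub]
    simp only [eval_sub, eval_X, eval_C, this]
    ring
  have hval_ne : ∀ x, (∀ i, x < r i) → (∏ i, (X - C (r' i))).eval x ≠ 0 := by
    intro x hx
    rw [hval x hx]
    refine mul_ne_zero (Finset.prod_ne_zero_iff.2 fun i _ => sub_ne_zero.2 (hx i).ne) ?_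
    have : 0 ≤ ∑ i, (r i - x)⁻¹ := Finset.sum_nonneg fun i _ => inv_nonneg.2 (sub_nonneg.2 (hx i).le)
    positivity
  have hb' : ∀ i, b + δ < r' i := by
    intro i
    by_contra hc
    push Not at hc
    refine hval_ne (r' i) (fun j => hc.trans_lt (hgap j)) ?_
    rw [eval_prod]
    exact Finset.prod_eq_zero (Finset.mem_univ i) (by simp)
  refine ⟨r', by rw [hp, hr'], hb', ?_⟩
  set x := b + δ with hx
  have hd := eval_derivative_prod_X_sub_C Finset.univ r x fun i _ => (hgap i).ne
  have hd' := (eval_derivative_prod_X_sub_C Finset.univ r' x fun i _ => (hb' i).ne).1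
  have hv := hval x hgap
  rw [eval_prod] at hv
  simp only [eval_sub, eval_X, eval_C] at hv
  rw [hv, ← hr', derivative_sub, derivative_C_mul, eval_sub, eval_mul, hd.1, hd.2, eval_C] at hd'
  have hflip : ∀ (t : Fin k → ℝ), ∑ i, (x - t i)⁻¹ = -∑ i, (t i - x)⁻¹ := by
    intro t
    rw [← Finset.sum_neg_distrib]
    exact Finset.sum_congr rfl fun i _ => by rw [← inv_neg, neg_sub]
  have hflip2 : ∑ i, ((x - r i)⁻¹) ^ 2 = ∑ i, ((r i - x)⁻¹) ^ 2 :=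
    Finset.sum_congr rfl fun i _ => by rw [← neg_sub, inv_neg, neg_sq]
  rw [hflip r, hflip r', hflip2] at hd'
  have hP : ∏ i, (x - r i) ≠ 0 := Finset.prod_ne_zero_iff.2 fun i _ => sub_ne_zero.2 (hgap i).ne
  have hineq := barrier_shift_inequality Finset.univ (fun i => r i - x)
    (fun i _ => sub_pos.2 (hgap i)) hlam hδ hα hδα (by
      refine le_trans (le_of_eq ?_) hsum
      exact Finset.sum_congr rfl fun i _ => by rw [hx]; congr 1; ring)
  have hpos : 0 < 1 + lam * ∑ i, (r i - x)⁻¹ := by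
    have : 0 ≤ ∑ i, (r i - x)⁻¹ :=
      Finset.sum_nonneg fun i _ => inv_nonneg.2 (sub_nonneg.2 (hgap i).le)
    positivity
  have heq : (∑ i, (r' i - x)⁻¹) * (1 + lam * ∑ i, (r i - x)⁻¹) =
      (∑ i, (r i - x)⁻¹) + lam * ((∑ i, (r i - x)⁻¹) ^ 2 - ∑ i, ((r i - x)⁻¹) ^ 2) := by
    apply mul_left_cancel₀ hP
    linear_combination hd'
  rw [← heq] at hineq
  exact le_of_mul_le_mul_right hineq hpos

/-! ### Rank-one updates of determinants -/

theorem det_add_vecMulVec_of_isUnit {n R : Type*} [Fintype n] [DecidableEq n] [CommRing R]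
    {A : Matrix n n R} (hA : IsUnit A.det) (u v : n → R) :
    (A + vecMulVec u v).det = A.det + v ⬝ᵥ A.adjugate *ᵥ u := by
  have h1 : (replicateRow Unit v * A⁻¹ * replicateCol Unit u) () () = v ⬝ᵥ A⁻¹ *ᵥ u := by
    rw [Matrix.mul_assoc]
    rfl
  rw [vecMulVec_eq Unit, det_add_replicateCol_mul_replicateRow hA,
    det_unique (1 + replicateRow Unit v * A⁻¹ * replicateCol Unit u), Matrix.add_apply,
    Matrix.one_apply_eq, PUnit.default_eq_unit, h1, Matrix.inv_def, smul_mulVec, dotProduct_smul,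
    smul_eq_mul, mul_add, mul_one, Ring.mul_inverse_cancel_left _ _ hA]

/-- The **matrix determinant lemma**, without an invertibility hypothesis. -/
theorem det_add_vecMulVec {n R : Type*} [Fintype n] [DecidableEq n] [CommRing R] [IsDomain R]
    (A : Matrix n n R) (u v : n → R) :
    (A + vecMulVec u v).det = A.det + v ⬝ᵥ A.adjugate *ᵥ u := by
  have map_lhs : ∀ {S T : Type _} [CommRing S] [CommRing T] (f : S →+* T) (B : Matrix n n S)
      (u v : n → S), f (B + vecMulVec u v).det =
        (f.mapMatrix B + vecMulVec (f ∘ u) (f ∘ v)).det := by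
    intro S T _ _ f B u v
    rw [RingHom.map_det, map_add]
    congr 2
    ext i j
    simp [vecMulVec_apply]
  have map_rhs : ∀ {S T : Type _} [CommRing S] [CommRing T] (f : S →+* T) (B : Matrix n n S)
      (u v : n → S), f (B.det + v ⬝ᵥ B.adjugate *ᵥ u) =
        (f.mapMatrix B).det + (f ∘ v) ⬝ᵥ (f.mapMatrix B).adjugate *ᵥ (f ∘ u) := by
    intro S T _ _ f B u v
    rw [map_add, RingHom.map_det, RingHom.map_dotProduct, ← RingHom.map_adjugate]
    congr 2
    ext i
    simp [RingHom.map_mulVec]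
  -- The determinant of `A + X • 1` is the monic characteristic polynomial of `-A`, so this matrix
  -- is invertible over the fraction field; specializing `X` to `0` recovers `A`.
  let B : Matrix n n R[X] := A.map C + (X : R[X]) • (1 : Matrix n n R[X])
  let φ := algebraMap R[X] (FractionRing R[X])
  have hφ : Function.Injective φ := IsFractionRing.injective _ _
  have hB : B.det ≠ 0 := by
    have : B = (-A).charmatrix := by
      ext i j
      simp [B, charmatrix_apply, Matrix.diagonal_apply, Matrix.one_apply, add_comm, smul_eq_mul]
    rw [this]
    exact (Matrix.charpoly_monic (-A)).ne_zero
  have h1 : (B + vecMulVec (C ∘ u) (C ∘ v)).det = B.det + (C ∘ v) ⬝ᵥ B.adjugate *ᵥ (C ∘ u) := by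
    apply hφ
    rw [map_lhs, map_rhs]
    refine det_add_vecMulVec_of_isUnit ?_ _ _
    rw [← RingHom.map_det]
    exact isUnit_iff_ne_zero.2 ((map_ne_zero_iff φ hφ).2 hB)
  have h2 := congrArg (evalRingHom (0 : R)) h1
  have hBm : (evalRingHom (0 : R)).mapMatrix B = A := by
    ext i j; simp [B]
  have hC : ∀ w : n → R, evalRingHom (0 : R) ∘ C ∘ w = w := fun w => by ext; simp
  rwa [map_lhs, map_rhs, hBm, hC, hC] at h2

/-! ### Averaged characteristic polynomials -/

section Average

variable {ι n K : Type*} [Fintype ι] [Fintype n] [DecidableEq n] [Field K]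

/-- The average of `x ^ j * det (C - x⁻¹ ∑ₛ vₛ vₛᵀ)` over `j` independent samples `vₛ` taken from
`v` with weights `p`. -/
def detAverage (p : ι → K) (v : ι → n → K) (x : K) : ℕ → Matrix n n K → K
  | 0, C => C.det
  | j + 1, C => ∑ i, p i * (x * detAverage p v x j (C - x⁻¹ • vecMulVec (v i) (v i)))

/-- The matrix whose rows are the vectors `v i` for `i` in the list `L`. -/
def rowsOfList (v : ι → n → K) (L : List ι) : Matrix (Fin L.length) n K :=
  Matrix.of fun s => v (L.get s)

/-- The average of the characteristic polynomials of the Gram matrices of the vectors listed by `L`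
together with `j` further independent samples from `v` with weights `p`. -/
noncomputable def gramAverage (p : ι → K) (v : ι → n → K) : ℕ → List ι → K[X]
  | 0, L => (rowsOfList v L * (rowsOfList v L)ᵀ).charpoly
  | j + 1, L => ∑ i, C (p i) * gramAverage p v j (i :: L)

omit [Fintype ι] [Fintype n] [DecidableEq n] in
theorem transpose_mul_rowsOfList (v : ι → n → K) (L : List ι) :
    (rowsOfList v L)ᵀ * rowsOfList v L = (L.map fun i => vecMulVec (v i) (v i)).sum := by
  ext a b
  rw [Matrix.mul_apply]
  simp only [transpose_apply, rowsOfList, of_apply]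
  rw [show ∑ s, v (L.get s) a * v (L.get s) b = (L.map fun i => v i a * v i b).sum from
    Fin.sum_univ_fun_getElem L fun i => v i a * v i b]
  induction L with
  | nil => simp
  | cons i L ih => simp [ih, vecMulVec_apply]

/-- Sylvester's identity trades `V Vᵀ`, whose size grows with the list, for `Vᵀ V` in fixed
dimension, where a new sample is a rank-one update. -/
theorem eval_gramAverage (p : ι → K) (v : ι → n → K) {x : K} (hx : x ≠ 0) (j : ℕ) (L : List ι) :
    (gramAverage p v j L).eval x = x ^ L.length *
      detAverage p v x j (1 - x⁻¹ • (L.map fun i => vecMulVec (v i) (v i)).sum) := by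
  induction j generalizing L with
  | zero =>
    have : Matrix.scalar (Fin L.length) x - rowsOfList v L * (rowsOfList v L)ᵀ =
        x • (1 - (x⁻¹ • rowsOfList v L) * (rowsOfList v L)ᵀ) := by
      rw [smul_sub, Matrix.smul_mul, smul_smul, mul_inv_cancel₀ hx, one_smul, smul_one_eq_diagonal]
      rfl
    rw [gramAverage, detAverage, eval_charpoly, this, det_smul, Fintype.card_fin,
      det_one_sub_mul_comm, Matrix.mul_smul, transpose_mul_rowsOfList]
  | succ j ih =>
    simp only [gramAverage, detAverage, eval_finsetSum, eval_mul, eval_C, ih, List.length_cons,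
      List.map_cons, List.sum_cons, Finset.mul_sum]
    refine Finset.sum_congr rfl fun i _ => ?_
    rw [smul_add, add_comm (x⁻¹ • _), ← sub_sub, pow_succ]
    ring

omit [DecidableEq n] in
theorem map_gramAverage {K' : Type*} [Field K'] (φ : K →+* K') (p : ι → K) (v : ι → n → K) (j : ℕ)
    (L : List ι) : (gramAverage p v j L).map φ =
      gramAverage (fun i => φ (p i)) (fun i a => φ (v i a)) j L := by
  induction j generalizing L with
  | zero =>
    rw [gramAverage, gramAverage, ← charpoly_map, Matrix.map_mul]
    rfl
  | succ j ih => simp [gramAverage, Polynomial.map_sum, ih]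

theorem exists_detAverage_add_smul (p : ι → K) (v : ι → n → K) (x : K) (j : ℕ) (C : Matrix n n K)
    (u w : n → K) : ∃ κ, ∀ t, detAverage p v x j (C + t • vecMulVec u w) =
      detAverage p v x j C + t * κ := by
  induction j generalizing C with
  | zero =>
    refine ⟨w ⬝ᵥ C.adjugate *ᵥ u, fun t => ?_⟩
    rw [detAverage, detAverage, ← smul_vecMulVec, det_add_vecMulVec, mulVec_smul, dotProduct_smul,
      smul_eq_mul]
  | succ j ih =>
    choose κ hκ using fun i => ih (C - x⁻¹ • vecMulVec (v i) (v i))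
    refine ⟨∑ i, p i * (x * κ i), fun t => ?_⟩
    rw [detAverage, detAverage, Finset.mul_sum, ← Finset.sum_add_distrib]
    refine Finset.sum_congr rfl fun i _ => ?_
    rw [add_sub_right_comm, hκ]
    ring

end Average

/-! ### Nonvanishing on the upper half plane -/

section UpperHalfPlane

variable {ι n : Type*} [Fintype ι] [Fintype n] [DecidableEq n]

/-- Complex matrices whose quadratic form vanishes only at `0` and has nonnegative imaginary
part. -/
def IsDissipative (C : Matrix n n ℂ) : Prop :=
  ∀ u : n → ℂ, u ≠ 0 → star u ⬝ᵥ C *ᵥ u ≠ 0 ∧ 0 ≤ (star u ⬝ᵥ C *ᵥ u).im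

open ComplexOrder in
theorem isDissipative_one : IsDissipative (1 : Matrix n n ℂ) := by
  intro u hu
  rw [one_mulVec]
  refine ⟨by rwa [Ne, dotProduct_star_self_eq_zero], le_of_eq ?_⟩
  simp [dotProduct, Complex.mul_im, mul_comm]

theorem IsDissipative.det_ne_zero {C : Matrix n n ℂ} (h : IsDissipative C) : C.det ≠ 0 := by
  intro h0
  obtain ⟨u, hu, hCu⟩ := exists_mulVec_eq_zero_iff.2 h0
  exact (h u hu).1 (by simp [hCu])

omit [DecidableEq n] in
theorem IsDissipative.add_smul_vecMulVec {C : Matrix n n ℂ} (h : IsDissipative C) (v : n → ℝ)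
    {t : ℂ} (ht : 0 < t.im) :
    IsDissipative (C + t • vecMulVec (fun a => (v a : ℂ)) fun a => (v a : ℂ)) := by
  intro u hu
  obtain ⟨h1, h2⟩ := h u hu
  set c : ℂ := (fun a => (v a : ℂ)) ⬝ᵥ u with hc
  have hstar : star u ⬝ᵥ (fun a => (v a : ℂ)) = star c := by
    simp [hc, dotProduct, mul_comm]
  have key : star u ⬝ᵥ (C + t • vecMulVec (fun a => (v a : ℂ)) fun a => (v a : ℂ)) *ᵥ u =
      star u ⬝ᵥ C *ᵥ u + t * (Complex.normSq c : ℂ) := by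
    rw [add_mulVec, dotProduct_add, smul_mulVec, vecMulVec_mulVec, dotProduct_smul,
      dotProduct_smul, hstar, ← hc, ← Complex.mul_conj]
    simp [mul_comm]
  have him : (star u ⬝ᵥ C *ᵥ u + t * (Complex.normSq c : ℂ)).im =
      (star u ⬝ᵥ C *ᵥ u).im + t.im * Complex.normSq c := by simp
  rw [key]
  rcases eq_or_ne c 0 with h0 | h0
  · simpa [h0] using And.intro h1 h2
  · have : 0 < t.im * Complex.normSq c := mul_pos ht (Complex.normSq_pos.2 h0)
    have hpos : 0 < (star u ⬝ᵥ C *ᵥ u + t * (Complex.normSq c : ℂ)).im := by rw [him]; linarith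
    exact ⟨fun h => by simp [h] at hpos, hpos.le⟩

theorem im_neg_inv_pos {x : ℂ} (hx : 0 < x.im) : 0 < (-x⁻¹).im := by
  have h0 : x ≠ 0 := by rintro rfl; simp at hx
  rw [Complex.neg_im, Complex.inv_im, neg_div, neg_neg]
  exact div_pos hx (Complex.normSq_pos.2 h0)

theorem im_detAverage_div_pos {p : ι → ℂ} {v : ι → n → ℂ} {x : ℂ} (hx : 0 < x.im) {j : ℕ}
    (h : ∀ C, IsDissipative C → detAverage p v x j C ≠ 0) {C : Matrix n n ℂ}
    (hC : IsDissipative C) (u : n → ℝ) :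
    0 < (x * detAverage p v x j (C - x⁻¹ • vecMulVec (fun a => (u a : ℂ)) fun a => (u a : ℂ)) /
      detAverage p v x j C).im := by
  obtain ⟨κ, hκ⟩ := exists_detAverage_add_smul p v x j C (fun a => (u a : ℂ)) fun a => (u a : ℂ)
  have hx0 : x ≠ 0 := by rintro rfl; simp at hx
  have h0 := h C hC
  set d := detAverage p v x j C with hd
  have hle : (κ / d).im ≤ 0 := by
    by_contra hc
    push Not at hc
    have hne : κ / d ≠ 0 := by intro h; simp [h] at hc
    -- The affine function `d + t * κ` vanishes at `t = -(κ / d)⁻¹`, which would lie in the upper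
    -- half plane.
    refine h _ (hC.add_smul_vecMulVec u (im_neg_inv_pos hc)) ?_
    rw [hκ]
    have hκ0 : κ ≠ 0 := by rintro rfl; simp at hne
    field_simp
    ring
  have : x * detAverage p v x j (C - x⁻¹ • vecMulVec (fun a => (u a : ℂ)) fun a => (u a : ℂ)) / d =
      x - κ / d := by
    rw [sub_eq_add_neg, ← neg_smul, hκ]
    field_simp
    ring
  rw [this, Complex.sub_im]
  linarith

/-- After division by the average with one sample fewer, every term has positive imaginary part, so
the terms cannot cancel. -/
theorem detAverage_ne_zero [Nonempty ι] {p : ι → ℝ} (hp : ∀ i, 0 < p i) (v : ι → n → ℝ) {x : ℂ}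
    (hx : 0 < x.im) (j : ℕ) (C : Matrix n n ℂ) (hC : IsDissipative C) :
    detAverage (fun i => (p i : ℂ)) (fun i a => (v i a : ℂ)) x j C ≠ 0 := by
  induction j generalizing C with
  | zero => exact hC.det_ne_zero
  | succ j ih =>
    intro h0
    have hpos : 0 < (∑ i, (p i : ℂ) * (x * detAverage (fun i => (p i : ℂ))
        (fun i a => (v i a : ℂ)) x j (C - x⁻¹ • vecMulVec (fun a => (v i a : ℂ))
          fun a => (v i a : ℂ)) / detAverage (fun i => (p i : ℂ)) (fun i a => (v i a : ℂ)) x j C)).im := by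
      rw [Complex.im_sum]
      refine Finset.sum_pos (fun i _ => ?_) Finset.univ_nonempty
      rw [Complex.im_ofReal_mul]
      exact mul_pos (hp i) (im_detAverage_div_pos hx ih hC (v i))
    rw [detAverage] at h0
    have : (∑ i, (p i : ℂ) * (x * detAverage (fun i => (p i : ℂ))
        (fun i a => (v i a : ℂ)) x j (C - x⁻¹ • vecMulVec (fun a => (v i a : ℂ))
          fun a => (v i a : ℂ)) / detAverage (fun i => (p i : ℂ)) (fun i a => (v i a : ℂ)) x j C)) = 0 := by
      simp_rw [mul_div_assoc', ← Finset.sum_div, h0, zero_div]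
    rw [this] at hpos
    simp at hpos

omit [Fintype ι] in
theorem isDissipative_one_sub_smul_sum (v : ι → n → ℝ) {x : ℂ} (hx : 0 < x.im) (L : List ι) :
    IsDissipative (1 - x⁻¹ • (L.map fun i =>
      vecMulVec (fun a => (v i a : ℂ)) fun a => (v i a : ℂ)).sum) := by
  induction L with
  | nil => simpa using isDissipative_one
  | cons i L ih =>
    have := ih.add_smul_vecMulVec (v i) (im_neg_inv_pos hx)
    convert this using 1
    simp only [List.map_cons, List.sum_cons, smul_add, neg_smul]
    abel

theorem aeval_gramAverage (p : ι → ℝ) (v : ι → n → ℝ) {x : ℂ} (hx : x ≠ 0) (j : ℕ) (L : List ι) :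
    aeval x (gramAverage p v j L) = x ^ L.length *
      detAverage (fun i => (p i : ℂ)) (fun i a => (v i a : ℂ)) x j (1 - x⁻¹ • (L.map fun i =>
        vecMulVec (fun a => (v i a : ℂ)) fun a => (v i a : ℂ)).sum) := by
  rw [← eval_map_algebraMap, map_gramAverage, eval_gramAverage _ _ hx]
  rfl

theorem im_aeval_gramAverage_div_pos [Nonempty ι] {p : ι → ℝ} (hp : ∀ i, 0 < p i)
    (v : ι → n → ℝ) {x : ℂ} (hx : 0 < x.im) (j : ℕ) (i : ι) (L : List ι) :
    0 < (aeval x (gramAverage p v j (i :: L)) / aeval x (gramAverage p v j L)).im := by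
  have h0 : x ≠ 0 := by rintro rfl; simp at hx
  have := im_detAverage_div_pos hx (detAverage_ne_zero hp v hx j)
    (isDissipative_one_sub_smul_sum v hx L) (v i)
  convert this using 2
  rw [aeval_gramAverage p v h0, aeval_gramAverage p v h0, List.length_cons, pow_succ, mul_assoc,
    mul_div_mul_left _ _ (pow_ne_zero _ h0), List.map_cons, List.sum_cons, smul_add, add_comm (x⁻¹ • _),
    ← sub_sub]

end UpperHalfPlane

/-! ### Selecting a good outcome -/

/-- A real rational function that maps the open upper half plane to the closed upper half plane is
monotone on every half line to the left of its poles. -/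
theorem monotoneOn_eval_div_of_im_nonneg {P G : ℝ[X]} {b : ℝ} (hG : ∀ x < b, G.eval x ≠ 0)
    (him : ∀ z : ℂ, 0 < z.im → 0 ≤ (aeval z P / aeval z G).im) :
    MonotoneOn (fun x => P.eval x / G.eval x) (Set.Iio b) := by
  have hd : ∀ x < b, HasDerivAt (fun x => P.eval x / G.eval x)
      (((derivative P).eval x * G.eval x - P.eval x * (derivative G).eval x) / G.eval x ^ 2) x :=
    fun x hx => (P.hasDerivAt x).div (G.hasDerivAt x) (hG x hx)
  refine monotoneOn_of_deriv_nonneg (convex_Iio b)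
    (fun x hx => (hd x hx).continuousAt.continuousWithinAt)
    (fun x hx => (hd x (interior_subset (s := Set.Iio b) hx)).differentiableAt.differentiableWithinAt) ?_
  intro x hx
  have hx : x < b := interior_subset (s := Set.Iio b) hx
  rw [(hd x hx).deriv]
  set d := ((derivative P).eval x * G.eval x - P.eval x * (derivative G).eval x) / G.eval x ^ 2
    with hd_def
  have hreal : ∀ p : ℝ[X], aeval (x : ℂ) p = ((p.eval x : ℝ) : ℂ) := fun p => by
    simpa using (aeval_algebraMap_apply ℂ x p)
  have hc : HasDerivAt (fun z : ℂ => aeval z P / aeval z G) (d : ℂ) (x : ℂ) := by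
    have := (P.hasDerivAt_aeval (x : ℂ)).div (G.hasDerivAt_aeval (x : ℂ))
      (by rw [hreal]; exact_mod_cast hG x hx)
    refine this.congr_deriv ?_
    simp only [hreal, hd_def]
    push_cast
    rfl
  -- Along `x + t * I` the imaginary part of the quotient is `0` at `t = 0` and nonnegative for `t >
  -- 0`, and its derivative at `0` is `d`.
  have hpath : HasDerivAt (fun t : ℝ => (x : ℂ) + t * Complex.I) Complex.I 0 := by
    simpa using ((Complex.ofRealCLM.hasDerivAt (x := (0 : ℝ))).mul_const Complex.I).const_add (x : ℂ)
  have hcomp : HasDerivAt (fun t : ℝ => aeval ((x : ℂ) + t * Complex.I) P /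
      aeval ((x : ℂ) + t * Complex.I) G) (d * Complex.I) 0 := by
    have hc' : HasDerivAt (fun z : ℂ => aeval z P / aeval z G) (d : ℂ)
        ((x : ℂ) + (0 : ℝ) * Complex.I) := by simpa using hc
    exact hc'.comp (0 : ℝ) hpath
  have himd : HasDerivAt (fun t : ℝ => (aeval ((x : ℂ) + t * Complex.I) P /
      aeval ((x : ℂ) + t * Complex.I) G).im) d 0 := by
    exact (Complex.imCLM.hasFDerivAt.comp_hasDerivAt (0 : ℝ) hcomp).congr_deriv (by simp)
  refine ge_of_tendsto himd.tendsto_slope_zero_right ?_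
  filter_upwards [self_mem_nhdsWithin] with t ht
  have ht : 0 < t := ht
  have h1 := him ((x : ℂ) + t * Complex.I) (by simpa using ht)
  have h2 : (aeval ((x : ℂ) + (0 : ℝ) * Complex.I) P /
      aeval ((x : ℂ) + (0 : ℝ) * Complex.I) G).im = 0 := by
    simp only [Complex.ofReal_zero, zero_mul, add_zero, hreal, ← Complex.ofReal_div,
      Complex.ofReal_im]
  rw [zero_add, h2, sub_zero, smul_eq_mul]
  positivity

/-- If a weighted sum of polynomials, all of whose quotients by `G` map the upper half plane to
itself, has no root below `b`, then neither does one of the summands. -/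
theorem exists_eval_ne_zero_of_sum {ι : Type*} [Fintype ι] [Nonempty ι] {p : ι → ℝ}
    (hp : ∀ i, 0 < p i) {G : ℝ[X]} {Q : ι → ℝ[X]} {b : ℝ}
    (hneg : ∀ x < 0, G.eval x ≠ 0 ∧ ∀ i, (Q i).eval x / G.eval x < 0)
    (him : ∀ i, ∀ z : ℂ, 0 < z.im → 0 ≤ (aeval z (Q i) / aeval z G).im)
    (hF : ∀ x < b, (∑ i, C (p i) * Q i).eval x ≠ 0) :
    ∃ i, ∀ x < b, (Q i).eval x ≠ 0 := by
  set F : ℝ[X] := ∑ i, C (p i) * Q i with hFdef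
  have hFG : ∀ x, F.eval x / G.eval x = ∑ i, p i * ((Q i).eval x / G.eval x) := fun x => by
    simp [hFdef, eval_finsetSum, Finset.sum_div, mul_div_assoc]
  have hFim : ∀ z : ℂ, 0 < z.im → 0 ≤ (aeval z F / aeval z G).im := by
    intro z hz
    have : aeval z F / aeval z G = ∑ i, (p i : ℂ) * (aeval z (Q i) / aeval z G) := by
      simp [hFdef, Finset.sum_div, mul_div_assoc]
    rw [this, Complex.im_sum]
    exact Finset.sum_nonneg fun i _ => by
      rw [Complex.im_ofReal_mul]; exact mul_nonneg (hp i).le (him i z hz)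
  have hFneg : ∀ x < 0, F.eval x / G.eval x < 0 := fun x hx => by
    rw [hFG]
    exact Finset.sum_neg (fun i _ => mul_neg_of_pos_of_neg (hp i) ((hneg x hx).2 i))
      Finset.univ_nonempty
  have hsign : ∀ c ≤ b, (∀ x < c, G.eval x ≠ 0) → ∀ x < c, F.eval x / G.eval x < 0 := by
    intro c hc hGc x hx
    by_contra hge
    push Not at hge
    have hy : min x (-1) < 0 := (min_le_right _ _).trans_lt (by norm_num)
    have hcont : ContinuousOn (fun x => F.eval x / G.eval x) (Set.Icc (min x (-1)) x) :=
      F.continuous.continuousOn.div G.continuous.continuousOn fun y hy => hGc y (hy.2.trans_lt hx)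
    obtain ⟨y, hy1, hy2⟩ := intermediate_value_Icc (min_le_left x (-1)) hcont
      ⟨(hFneg _ hy).le, hge⟩
    have hyc : y < c := hy1.2.trans_lt hx
    exact (div_ne_zero (hF y (hyc.trans_le hc)) (hGc y hyc)) hy2
  have hG0 : G ≠ 0 := fun h => (hneg (-1) (by norm_num)).1 (by simp [h])
  -- Left of the least root `β` of `G`, the quotient `F / G` is increasing and negative, hence
  -- bounded near `β`; so `β < b` would also be a root of `F`.
  have hGb : ∀ x < b, G.eval x ≠ 0 := by
    by_contra! hcon
    obtain ⟨x₀, hx₀, hx₀'⟩ := hcon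
    obtain ⟨β, hβ, hmin⟩ := G.roots.toFinset.exists_min_image id
      ⟨x₀, by simpa [hG0] using hx₀'⟩
    have hβroot : G.eval β = 0 := by simpa [hG0] using hβ
    have hβmin : ∀ x < β, G.eval x ≠ 0 := fun x hx h =>
      absurd (hmin x (by simpa [hG0] using h)) (not_le.2 hx)
    have hβb : β < b := (hmin x₀ (by simpa [hG0] using hx₀')).trans_lt hx₀
    have hβ0 : 0 ≤ β := by
      by_contra! h
      exact (hneg β h).1 hβroot
    have hmono := monotoneOn_eval_div_of_im_nonneg hβmin hFim
    set c := F.eval (-1) / G.eval (-1) with hc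
    have hbound : ∀ x, -1 < x → x < β → |F.eval x| ≤ |c| * |G.eval x| := by
      intro x hx1 hxβ
      have h1 : c ≤ F.eval x / G.eval x :=
        hmono (show (-1 : ℝ) < β by linarith) hxβ hx1.le
      have h2 := hsign β hβb.le hβmin x hxβ
      have h3 : |F.eval x / G.eval x| ≤ |c| := by
        rw [abs_of_neg h2, abs_of_neg (h1.trans_lt h2)]; linarith
      rwa [abs_div, div_le_iff₀ (abs_pos.2 (hβmin x hxβ))] at h3
    have hlim : |F.eval β| ≤ |c| * |G.eval β| := by
      refine le_of_tendsto_of_tendsto (b := nhdsWithin β (Set.Iio β))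
        (F.continuous.abs.continuousWithinAt) ((continuous_const.mul G.continuous.abs).continuousWithinAt) ?_
      filter_upwards [Ioo_mem_nhdsLT (show (-1 : ℝ) < β by linarith)] with x hx
      exact hbound x hx.1 hx.2
    rw [hβroot, abs_zero, mul_zero] at hlim
    exact hF β hβb (abs_eq_zero.1 (le_antisymm hlim (abs_nonneg _)))
  by_contra! hcon
  choose r hrb hr using hcon
  -- To the right of all the roots `r i` every `Q i / G` is nonnegative by monotonicity, whereas the
  -- weighted sum `F / G` is still negative below `b`.
  obtain ⟨i₀, -, hi₀⟩ := Finset.univ.exists_max_image r Finset.univ_nonempty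
  obtain ⟨x, hx1, hx2⟩ := exists_between (hrb i₀)
  have hx := hsign b le_rfl hGb x hx2
  rw [hFG] at hx
  obtain ⟨i, -, hi⟩ := Finset.exists_lt_of_sum_lt (by simpa using hx :
    ∑ i, p i * ((Q i).eval x / G.eval x) < ∑ i : ι, (0 : ℝ))
  have hi' : (Q i).eval x / G.eval x < 0 := by
    by_contra! h
    exact absurd hi (not_lt.2 (mul_nonneg (hp i).le h))
  have := monotoneOn_eval_div_of_im_nonneg hGb (him i) (hrb i) hx2
    ((hi₀ i (Finset.mem_univ i)).trans hx1.le)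
  simp only [hr i, zero_div] at this
  linarith

section

variable {ι n : Type*} [Fintype ι] [Fintype n] [DecidableEq n]

omit [DecidableEq n] in
-- For `x < 0` the matrix `V Vᵀ - x` is positive definite, so the sign depends only on the number of
-- vectors.
theorem neg_one_pow_mul_eval_gramAverage_pos [Nonempty ι] {p : ι → ℝ} (hp : ∀ i, 0 < p i)
    (v : ι → n → ℝ) {x : ℝ} (hx : x < 0) (j : ℕ) (L : List ι) :
    0 < (-1) ^ (j + L.length) * (gramAverage p v j L).eval x := by
  induction j generalizing L with
  | zero =>
    set V := rowsOfList v L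
    have hpos : ((-x) • (1 : Matrix (Fin L.length) (Fin L.length) ℝ) + V * Vᵀ).PosDef :=
      (PosDef.one.smul (neg_pos.2 hx)).add_posSemidef (posSemidef_self_mul_conjTranspose V)
    have heq : Matrix.scalar (Fin L.length) x - V * Vᵀ =
        -((-x) • (1 : Matrix (Fin L.length) (Fin L.length) ℝ) + V * Vᵀ) := by
      rw [neg_add, neg_smul, neg_neg, smul_one_eq_diagonal, sub_eq_add_neg]
      rfl
    rw [gramAverage, eval_charpoly, heq, det_neg, Fintype.card_fin, zero_add, ← mul_assoc,
      ← mul_pow]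
    simpa using hpos.det_pos
  | succ j ih =>
    rw [gramAverage, eval_finsetSum, Finset.mul_sum]
    refine Finset.sum_pos (fun i _ => ?_) Finset.univ_nonempty
    have := mul_pos (hp i) (ih (i :: L))
    rw [List.length_cons] at this
    rw [eval_mul, eval_C]
    convert this using 1
    ring

theorem exists_gramAverage_cons [Nonempty ι] {p : ι → ℝ} (hp : ∀ i, 0 < p i)
    (v : ι → n → ℝ) {b : ℝ} (j : ℕ) (L : List ι)
    (h : ∀ x < b, (gramAverage p v (j + 1) L).eval x ≠ 0) :
    ∃ i, ∀ x < b, (gramAverage p v j (i :: L)).eval x ≠ 0 := by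
  refine exists_eval_ne_zero_of_sum hp (G := gramAverage p v j L) (fun x hx => ?_)
    (fun i z hz => (im_aeval_gramAverage_div_pos hp v hz j i L).le) h
  have h1 := neg_one_pow_mul_eval_gramAverage_pos hp v hx j L
  refine ⟨right_ne_zero_of_mul h1.ne', fun i => ?_⟩
  have h2 := neg_one_pow_mul_eval_gramAverage_pos hp v hx j (i :: L)
  rw [List.length_cons, ← add_assoc, pow_succ] at h2
  have h3 := div_pos h2 h1
  rw [mul_assoc, mul_div_mul_left _ _ (pow_ne_zero _ (by norm_num)), neg_one_mul, neg_div] at h3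
  linarith

theorem exists_list_gramAverage [Nonempty ι] {p : ι → ℝ} (hp : ∀ i, 0 < p i)
    (v : ι → n → ℝ) {b : ℝ} (j : ℕ) (L : List ι)
    (h : ∀ x < b, (gramAverage p v j L).eval x ≠ 0) :
    ∃ L' : List ι, L'.length = j + L.length ∧
      ∀ x < b, (rowsOfList v L' * (rowsOfList v L')ᵀ).charpoly.eval x ≠ 0 := by
  induction j generalizing L with
  | zero => exact ⟨L, by simp, h⟩
  | succ j ih =>
    obtain ⟨i, hi⟩ := exists_gramAverage_cons hp v j L h
    obtain ⟨L', hL', h'⟩ := ih (i :: L) hi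
    exact ⟨L', by rw [hL', List.length_cons]; ring, h'⟩

end

/-! ### Closed form of the average -/

/-- **Jacobi's formula** for matrices of polynomials. -/
theorem derivative_det {n R : Type*} [Fintype n] [DecidableEq n] [CommRing R]
    (N : Matrix n n R[X]) :
    derivative N.det = (N.adjugate * N.map derivative).trace := by
  have h1 : ∀ i, (N.adjugate * N.map derivative) i i =
      (N.updateCol i fun a => derivative (N a i)).det := by
    intro i
    rw [← cramer_apply, cramer_eq_adjugate_mulVec]
    rfl
  rw [Matrix.trace]
  simp only [diag_apply, h1, det_apply']
  rw [Finset.sum_comm, derivative_sum]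
  refine Finset.sum_congr rfl fun σ _ => ?_
  rw [derivative_mul, derivative_intCast, zero_mul, zero_add, derivative_prod_finset,
    ← Finset.mul_sum]
  congr 1
  refine Finset.sum_congr rfl fun i _ => ?_
  rw [← Finset.mul_prod_erase _ _ (Finset.mem_univ i), mul_comm]
  congr 1
  · simp
  · refine Finset.prod_congr rfl fun j hj => ?_
    rw [updateCol_ne (Finset.ne_of_mem_erase hj)]

/-- The operator `g ↦ x g - g'`. -/
noncomputable def subDerivative {K : Type*} [Field K] (x : K) : K[X] →ₗ[K] K[X] :=
  x • LinearMap.id - derivative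

theorem subDerivative_apply {K : Type*} [Field K] (x : K) (g : K[X]) :
    subDerivative x g = C x * g - derivative g := by
  simp [subDerivative, smul_eq_C_mul]

/-- Iterates the commutation of `X` with `x - D`. At `k = 0` the truncated exponent is harmless
because its coefficient is `0`. -/
theorem subDerivative_pow_X_mul {K : Type*} [Field K] (x : K) (k : ℕ) (g : K[X]) :
    (subDerivative x ^ k) (X * g) =
      X * (subDerivative x ^ k) g - (k : K[X]) * (subDerivative x ^ (k - 1)) g := by
  induction k with
  | zero => simp
  | succ k ih =>
    rw [pow_succ', Module.End.mul_apply, ih, Module.End.mul_apply]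
    have h : (k : K[X]) * (subDerivative x ^ k) g =
        subDerivative x ((k : K[X]) * (subDerivative x ^ (k - 1)) g) := by
      cases k with
      | zero => simp
      | succ k =>
        rw [Nat.add_sub_cancel, pow_succ', Module.End.mul_apply, subDerivative_apply,
          subDerivative_apply, derivative_mul, derivative_natCast]
        ring
    rw [map_sub, ← h, Nat.add_sub_cancel, subDerivative_apply, subDerivative_apply,
      derivative_mul, derivative_X]
    push_cast
    ring

/-- The polynomial `∏ (1 - λ d/dX) X ^ k`, the product being over the list of the `λ`. -/
noncomputable def shiftedPow {K : Type*} [Field K] (k : ℕ) : List K → K[X]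
  | [] => X ^ k
  | a :: l => shiftedPow k l - C a * derivative (shiftedPow k l)

theorem derivative_shiftedPow {K : Type*} [Field K] (k : ℕ) (l : List K) :
    derivative (shiftedPow k l) = C (k : K) * shiftedPow (k - 1) l := by
  induction l with
  | nil => simp [shiftedPow, derivative_X_pow]
  | cons a l ih =>
    simp only [shiftedPow, derivative_sub, derivative_C_mul, ih]
    ring

/-- A duality between the two variables: multiplying by `1 + a * X` on the right corresponds to `1 -
a * D` on the left, since commuting `X` past `(x - D) ^ k` differentiates in `x`, and the remaining
multiple of `X` dies at `0`. -/
theorem eval_shiftedPow {K : Type*} [Field K] (x : K) (k : ℕ) (l : List K) :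
    (shiftedPow k l).eval x =
      ((subDerivative x ^ k) (l.map fun a => 1 + C a * X).prod).eval 0 := by
  induction l generalizing k with
  | nil =>
    have : ∀ k : ℕ, (subDerivative x ^ k) (1 : K[X]) = C (x ^ k) := by
      intro k
      induction k with
      | zero => simp
      | succ k ih => rw [pow_succ', Module.End.mul_apply, ih, subDerivative_apply, derivative_C,
        sub_zero, ← C_mul, pow_succ']
    simp [shiftedPow, this]
  | cons a l ih =>
    rw [shiftedPow, derivative_shiftedPow, List.map_cons, List.prod_cons, add_mul, one_mul,
      mul_assoc, map_add, ← smul_eq_C_mul (p := X * _), map_smul, subDerivative_pow_X_mul]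
    simp [ih]
    ring

section

variable {ι n K : Type*} [Fintype ι] [Fintype n] [DecidableEq n] [Field K]

/-- Averaging over one sample acts as `x - D`: the determinant lemma makes each update linear in the
adjugate, and Jacobi's formula identifies the average of these terms with the derivative. -/
theorem sum_det_sub_smul_vecMulVec {p : ι → K} (hp : ∑ i, p i = 1) (v : ι → n → K) {x : K}
    (hx : x ≠ 0) (C₀ : Matrix n n K) :
    ∑ i, (p i * x) • ((C₀ - x⁻¹ • vecMulVec (v i) (v i)).map C +
        (X : K[X]) • (∑ i, p i • vecMulVec (v i) (v i)).map C).det =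
      subDerivative x (C₀.map C + (X : K[X]) • (∑ i, p i • vecMulVec (v i) (v i)).map C).det := by
  set M := ∑ i, p i • vecMulVec (v i) (v i) with hM
  set N : Matrix n n K[X] := C₀.map C + (X : K[X]) • M.map C with hN
  have h1 : ∀ i, ((C₀ - x⁻¹ • vecMulVec (v i) (v i)).map C + (X : K[X]) • M.map C).det =
      N.det - C x⁻¹ * ((C ∘ v i) ⬝ᵥ N.adjugate *ᵥ (C ∘ v i)) := by
    intro i
    have : (C₀ - x⁻¹ • vecMulVec (v i) (v i)).map C + (X : K[X]) • M.map C =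
        N + vecMulVec (-(C x⁻¹) • (C ∘ v i)) (C ∘ v i) := by
      ext1 a b
      simp only [hN, Matrix.add_apply, Matrix.map_apply, Matrix.sub_apply, Matrix.smul_apply,
        vecMulVec_apply, smul_eq_mul, map_sub, map_mul, Pi.smul_apply, Function.comp_apply]
      ring
    rw [this, det_add_vecMulVec, mulVec_smul, dotProduct_smul, smul_eq_mul]
    ring
  have h2 : derivative N.det = ∑ i, C (p i) * ((C ∘ v i) ⬝ᵥ N.adjugate *ᵥ (C ∘ v i)) := by
    have hN' : N.map derivative = ∑ i, C (p i) • vecMulVec (C ∘ v i) (C ∘ v i) := by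
      ext1 a b
      simp [hN, hM, Matrix.sum_apply, vecMulVec_apply, derivative_mul]
    rw [derivative_det, hN', Matrix.mul_sum, trace_sum]
    refine Finset.sum_congr rfl fun i _ => ?_
    rw [Matrix.mul_smul, trace_smul, mul_vecMulVec, trace_vecMulVec, dotProduct_comm, smul_eq_mul]
  rw [subDerivative_apply, h2]
  simp only [h1, smul_eq_C_mul, mul_sub, Finset.sum_sub_distrib, ← Finset.sum_mul, ← map_sum, hp,
    one_mul]
  congr 1
  refine Finset.sum_congr rfl fun i _ => ?_
  rw [← mul_assoc, ← C_mul, mul_assoc, mul_inv_cancel₀ hx, mul_one]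

theorem detAverage_eq_eval {p : ι → K} (hp : ∑ i, p i = 1) (v : ι → n → K) {x : K}
    (hx : x ≠ 0) (j : ℕ) (C₀ : Matrix n n K) :
    detAverage p v x j C₀ = ((subDerivative x ^ j)
      (C₀.map C + (X : K[X]) • (∑ i, p i • vecMulVec (v i) (v i)).map C).det).eval 0 := by
  induction j generalizing C₀ with
  | zero =>
    rw [detAverage, pow_zero, Module.End.one_apply, ← coe_evalRingHom, RingHom.map_det]
    congr 1
    ext a b
    simp
  | succ j ih =>
    rw [pow_succ, Module.End.mul_apply, ← sum_det_sub_smul_vecMulVec hp v hx, map_sum,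
      eval_finsetSum, detAverage]
    refine Finset.sum_congr rfl fun i _ => ?_
    rw [map_smul, eval_smul, smul_eq_mul, ih, mul_assoc]

end

section

variable {ι n : Type*} [Fintype ι] [Fintype n] [DecidableEq n]

theorem det_one_add_X_smul_eq_prod {M : Matrix n n ℝ} (hM : M.IsHermitian) :
    (1 + (X : ℝ[X]) • M.map C).det = ∏ a, (1 + C (hM.eigenvalues a) * X) := by
  refine Polynomial.eq_of_infinite_eval_eq _ _ (Set.Infinite.mono (s := {0}ᶜ) (fun y hy => ?_)
    (Set.finite_singleton (0 : ℝ)).infinite_compl)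
  have hy : y ≠ 0 := hy
  have h1 := congrArg (eval (-y⁻¹)) hM.charpoly_eq
  rw [eval_charpoly, eval_prod] at h1
  have h2 : (evalRingHom y).mapMatrix (1 + (X : ℝ[X]) • M.map C) =
      (-y) • (Matrix.scalar n (-y⁻¹) - M) := by
    ext a b
    by_cases hab : a = b <;> simp [hab, mul_sub, hy, mul_comm y]
  show eval y (1 + (X : ℝ[X]) • M.map C).det = eval y _
  rw [← coe_evalRingHom, RingHom.map_det, h2, det_smul, h1, ← Finset.card_univ,
    ← Finset.prod_const, ← Finset.prod_mul_distrib, coe_evalRingHom, eval_prod]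
  refine Finset.prod_congr rfl fun a _ => ?_
  simp
  field_simp
  ring

/-- The average characteristic polynomial depends only on the eigenvalues of the second moment
matrix. -/
theorem gramAverage_nil {p : ι → ℝ} (hp : ∑ i, p i = 1) (v : ι → n → ℝ)
    (hM : (∑ i, p i • vecMulVec (v i) (v i)).IsHermitian) (k : ℕ) :
    gramAverage p v k [] = shiftedPow k ((Finset.univ : Finset n).toList.map hM.eigenvalues) := by
  refine Polynomial.eq_of_infinite_eval_eq _ _ (Set.Infinite.mono (s := {0}ᶜ) (fun x hx => ?_)
    (Set.finite_singleton (0 : ℝ)).infinite_compl)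
  have hx : x ≠ 0 := hx
  show (gramAverage p v k []).eval x = _
  rw [eval_gramAverage p v hx, eval_shiftedPow, detAverage_eq_eval hp v hx]
  simp only [List.length_nil, pow_zero, one_mul, List.map_nil, List.sum_nil, smul_zero, sub_zero,
    List.map_map]
  rw [Matrix.map_one _ (map_zero C) (map_one C), det_one_add_X_smul_eq_prod hM,
    ← Finset.prod_map_toList]
  rfl

end

/-! ### Location of the roots of the average -/

/-- For `X ^ k` the barrier value at `-(k / α)` is exactly `α`; each derivative factor then adds its
shift. -/
theorem hasLowerBarrier_shiftedPow {k : ℕ} (hk : k ≠ 0) {α : ℝ} (hα : 0 < α) (l : List ℝ)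
    (hl : ∀ a ∈ l, 0 ≤ a) :
    HasLowerBarrier (shiftedPow k l) k (-(k / α) + (l.map fun a => a / (1 + a * α)).sum) α := by
  induction l with
  | nil =>
    have hk' : (0 : ℝ) < k := by positivity
    refine ⟨fun _ => 0, by simp [shiftedPow], fun _ => ?_, ?_⟩
    · simp only [List.map_nil, List.sum_nil, add_zero, Left.neg_neg_iff]; positivity
    · simp only [List.map_nil, List.sum_nil, add_zero, zero_sub, neg_neg, inv_div,
        Finset.sum_const, Finset.card_univ, Fintype.card_fin, nsmul_eq_mul]
      rw [mul_div_cancel₀ _ hk'.ne']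
  | cons a l ih =>
    have := (ih fun b hb => hl b (List.mem_cons_of_mem _ hb)).sub_derivative hα
      (hl a List.mem_cons_self)
    rw [List.map_cons, List.sum_cons, add_comm (a / _), ← add_assoc]
    exact this

/-- All roots of `∏ (1 - λ d/dX) X ^ k` are at least `ε² ∑ λ`, provided that
`k - 1 ≤ (1 - ε)² (∑ λ)² / ∑ λ²`. -/
theorem eval_shiftedPow_ne_zero {n : Type*} [Fintype n] {lam : n → ℝ} (hlam : ∀ a, 0 ≤ lam a)
    (hpos : 0 < ∑ a, lam a) {ε : ℝ} (hε0 : 0 < ε) (hε1 : ε < 1) {k : ℕ}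
    (hk : (k : ℝ) ≤ (1 - ε) ^ 2 * ((∑ a, lam a) ^ 2 / ∑ a, lam a ^ 2)) {x : ℝ}
    (hx : x < ε ^ 2 * ∑ a, lam a) :
    (shiftedPow (k + 1) ((Finset.univ : Finset n).toList.map lam)).eval x ≠ 0 := by
  set T := ∑ a, lam a with hT
  set Q := ∑ a, lam a ^ 2 with hQ
  have hQpos : 0 < Q := by
    refine lt_of_le_of_ne (Finset.sum_nonneg fun a _ => sq_nonneg _) fun h => hpos.ne' ?_
    refine Finset.sum_eq_zero fun a ha => ?_
    have := (Finset.sum_eq_zero_iff_of_nonneg fun a _ => sq_nonneg (lam a)).1 h.symm a ha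
    simpa using this
  have h1ε : 0 < 1 - ε := by linarith
  set α := (1 - ε) / ε * (T / Q) with hαdef
  have hα : 0 < α := by positivity
  obtain ⟨r, hr, hb, hsum⟩ := hasLowerBarrier_shiftedPow (Nat.succ_ne_zero k) hα
    ((Finset.univ : Finset n).toList.map lam) (by simpa using hlam)
  set b := -(((k + 1 : ℕ) : ℝ) / α) +
    (((Finset.univ : Finset n).toList.map lam).map fun a => a / (1 + a * α)).sum with hbdef
  have hbval : b = -((k + 1) / α) + ∑ a, lam a / (1 + lam a * α) := by
    rw [hbdef, List.map_map, ← Finset.sum_map_toList]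
    push_cast
    rfl
  have htangent : ε * T ≤ ∑ a, lam a / (1 + lam a * α) := by
    -- Tangent line of `1 / u` at `u = 1 / ε`, with `u = 1 + lam a * α`.
    have h1 : ∀ a, lam a * (2 * ε - ε ^ 2) - ε ^ 2 * α * lam a ^ 2 ≤ lam a / (1 + lam a * α) := by
      intro a
      have hden : 0 < 1 + lam a * α := by have := hlam a; positivity
      rw [le_div_iff₀ hden]
      have := mul_nonneg (hlam a) (sq_nonneg (1 - ε * (1 + lam a * α)))
      linarith
    have h2 := Finset.sum_le_sum fun a (_ : a ∈ Finset.univ) => h1 a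
    rw [Finset.sum_sub_distrib, ← Finset.sum_mul, ← Finset.mul_sum, ← hT, ← hQ] at h2
    have h3 : ε ^ 2 * α * Q = ε * (1 - ε) * T := by rw [hαdef]; field_simp
    rw [h3] at h2
    linarith
  have hkα : k / α ≤ ε * (1 - ε) * T := by
    rw [div_le_iff₀ hα]
    refine hk.trans (le_of_eq ?_)
    rw [hαdef]
    field_simp
  have hroot : ∀ i, ε ^ 2 * T ≤ r i := by
    intro i
    have h1 : (r i - b)⁻¹ ≤ α :=
      (Finset.single_le_sum (f := fun i => (r i - b)⁻¹)
        (fun j _ => inv_nonneg.2 (sub_nonneg.2 (hb j).le)) (Finset.mem_univ i)).trans hsum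
    -- The roots clear the barrier by a further `1 / α`, which pays for the extra sample in `k + 1`.
    have h2 : α⁻¹ ≤ r i - b := inv_le_of_inv_le₀ (sub_pos.2 (hb i)) h1
    have h3 : (k + 1) / α = k / α + α⁻¹ := by rw [add_div, one_div]
    rw [hbval, h3] at h2
    linarith
  rw [hr, eval_prod]
  refine Finset.prod_ne_zero_iff.2 fun i _ => ?_
  have := hroot i
  simp only [eval_sub, eval_X, eval_C]
  intro h
  linarith

/-! ### From eigenvalues to the restricted invertibility bound -/

/-- Sums over the squared singular values agree with sums over the eigenvalues of `A Aᵀ`. -/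
theorem singularValues_sum_eq {n m : ℕ} (A : Matrix (Fin n) (Fin m) ℝ)
    (hM : (A * Aᵀ).IsHermitian) (f g : ℝ → ℝ) (hf : f 0 = 0) (hfg : ∀ s, g s = f (s ^ 2)) :
    ((toEuclideanLin A).singularValues.sum fun _ s => g s) = ∑ a, f (hM.eigenvalues a) := by
  set T := toEuclideanLin A with hT
  have hfin : Module.finrank ℝ (EuclideanSpace ℝ (Fin m)) = m := by simp
  have hchar : (LinearMap.adjoint T ∘ₗ T).charpoly = (Aᵀ * A).charpoly := by
    rw [hT, ← toEuclideanLin_conjTranspose_eq_adjoint, conjTranspose_eq_transpose_of_trivial,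
      ← toLpLin_mul, toLpLin_eq_toLin, charpoly_toLin]
  -- The two spectra differ only in the multiplicity of `0`, invisible because `f 0 = 0`.
  have hroots : ((Aᵀ * A).charpoly.roots.map f).sum = ((A * Aᵀ).charpoly.roots.map f).sum := by
    have h := congrArg (fun p : ℝ[X] => (p.roots.map f).sum) (charpoly_mul_comm' Aᵀ A)
    have hX : ∀ (k : ℕ) {q : ℝ[X]}, q.Monic → ((X ^ k * q).roots.map f).sum =
        (q.roots.map f).sum := by
      intro k q hq
      rw [roots_mul (mul_ne_zero (pow_ne_zero _ X_ne_zero) hq.ne_zero), roots_pow, roots_X]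
      simp [Multiset.map_nsmul, Multiset.sum_nsmul, hf]
    simpa only [hX _ (charpoly_monic _)] using h
  have hsym := T.isSymmetric_adjoint_comp_self
  have h1 : T.singularValues.sum (fun _ s => g s) = ∑ i : Fin m, f (hsym.eigenvalues hfin i) := by
    rw [Finsupp.sum_of_support_subset _ (s := Finset.range m) ?_ _ (by simp [hfg, hf]),
      Finset.sum_range]
    · exact Finset.sum_congr rfl fun i _ => by rw [hfg, T.sq_singularValues_fin hfin]
    · intro i hi
      by_contra hc
      exact Finsupp.mem_support_iff.1 hi
        (T.singularValues_of_finrank_le (by simpa using hc))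
  rw [h1]
  have h2 := hsym.roots_charpoly_eq_eigenvalues hfin
  rw [hchar] at h2
  rw [h2, hM.roots_charpoly_eq_eigenvalues] at hroots
  rwa [Multiset.map_map, Multiset.map_map] at hroots

/-- A lower bound for the roots of the characteristic polynomial of `V Vᵀ` is a lower bound for the
quadratic form. -/
theorem le_dotProduct_transpose_mulVec {κ n : Type*} [Fintype κ] [DecidableEq κ] [Fintype n]
    (V : Matrix κ n ℝ) {b : ℝ} (h : ∀ x < b, (V * Vᵀ).charpoly.eval x ≠ 0) (c : κ → ℝ) :
    b * (c ⬝ᵥ c) ≤ (Vᵀ *ᵥ c) ⬝ᵥ (Vᵀ *ᵥ c) := by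
  have hH : (V * Vᵀ - b • (1 : Matrix κ κ ℝ)).IsHermitian :=
    (isHermitian_mul_conjTranspose_self V).sub
      (by rw [IsHermitian, conjTranspose_smul, conjTranspose_one, star_trivial])
  have hpsd : (V * Vᵀ - b • (1 : Matrix κ κ ℝ)).PosSemidef := by
    rw [hH.posSemidef_iff_eigenvalues_nonneg]
    intro i
    by_contra hc
    have hroot : (V * Vᵀ - b • (1 : Matrix κ κ ℝ)).charpoly.eval (hH.eigenvalues i) = 0 := by
      rw [hH.charpoly_eq, eval_prod]
      exact Finset.prod_eq_zero (Finset.mem_univ i) (by simp)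
    refine h (hH.eigenvalues i + b) ?_ ?_
    · simp only [Pi.zero_apply, not_le] at hc
      linarith
    · rw [eval_charpoly] at hroot ⊢
      have hscalar : Matrix.scalar κ b = b • (1 : Matrix κ κ ℝ) := by
        rw [smul_one_eq_diagonal]
        rfl
      rw [← hroot, map_add, hscalar, sub_sub_eq_add_sub]
  have := hpsd.dotProduct_mulVec_nonneg c
  rw [star_trivial, sub_mulVec, smul_mulVec, one_mulVec, dotProduct_sub, dotProduct_smul,
    smul_eq_mul, ← mulVec_mulVec, dotProduct_mulVec, ← mulVec_transpose] at this
  linarith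

theorem nodup_of_forall_eval_ne_zero {ι n : Type*} [Fintype n] (v : ι → n → ℝ)
    {L : List ι} {b : ℝ} (hb : 0 < b)
    (h : ∀ x < b, (rowsOfList v L * (rowsOfList v L)ᵀ).charpoly.eval x ≠ 0) : L.Nodup := by
  rw [List.nodup_iff_injective_get]
  intro s t hst
  by_contra hne
  -- Equal rows make the difference of two basis vectors a null vector, contradicting `b > 0`.
  have hle := le_dotProduct_transpose_mulVec (rowsOfList v L) h
    (Pi.single s 1 - Pi.single t 1)
  have h0 : (rowsOfList v L)ᵀ *ᵥ (Pi.single s 1 - Pi.single t 1) = 0 := by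
    rw [mulVec_sub, mulVec_single_one, mulVec_single_one]
    ext a
    simp only [Pi.sub_apply, col_apply, transpose_apply, rowsOfList, of_apply, hst, sub_self,
      Pi.zero_apply]
  rw [h0, dotProduct_zero] at hle
  have : (Pi.single s 1 - Pi.single t 1 : Fin L.length → ℝ) ⬝ᵥ
      (Pi.single s 1 - Pi.single t 1) = 2 := by
    simp [dotProduct_sub, hne, Ne.symm hne]
    norm_num
  rw [this] at hle
  linarith

theorem frobenius_norm_sq_eq {ι κ : Type*} [Fintype ι] [Fintype κ] (A : Matrix ι κ ℝ) :
    ‖A‖ ^ 2 = ∑ i, ∑ j, A i j ^ 2 := by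
  rw [frobenius_norm_def, ← Real.sqrt_eq_rpow, Real.sq_sqrt (by positivity)]
  simp

/-- Restricted invertibility for weighted columns: the columns listed by `L` are distinct and their
weighted combinations are bounded below. -/
theorem exists_list_restricted_invertibility {n m : ℕ} (A : Matrix (Fin n) (Fin m) ℝ) (hA : A ≠ 0)
    {ε : ℝ} (hε0 : 0 < ε) (hε1 : ε < 1) {w : Fin m → ℝ} (hw : ∀ i, w i ≠ 0) {ω : ℝ} (hω : 0 < ω)
    (hωw : ω ^ 2 = ∑ i, (w i)⁻¹ ^ 2) :
    ∃ L : List (Fin m), L.length = ⌊(1 - ε) ^ 2 * srank4 A⌋₊ + 1 ∧ L.Nodup ∧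
      ∀ c : Fin L.length → ℝ, ε ^ 2 * ‖A‖ ^ 2 * (c ⬝ᵥ c) ≤
        ((rowsOfList (fun i a => ω * w i * A a i) L)ᵀ *ᵥ c) ⬝ᵥ
          ((rowsOfList (fun i a => ω * w i * A a i) L)ᵀ *ᵥ c) := by
  have : Nonempty (Fin m) := by
    by_contra hm
    rw [not_nonempty_iff] at hm
    exact hA (by ext i j; exact hm.elim j)
  set p : Fin m → ℝ := fun i => (w i)⁻¹ ^ 2 / ω ^ 2 with hp
  set v : Fin m → Fin n → ℝ := fun i a => ω * w i * A a i with hv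
  have hppos : ∀ i, 0 < p i := fun i => by
    have := inv_ne_zero (hw i)
    positivity
  have hpsum : ∑ i, p i = 1 := by
    rw [hp, ← Finset.sum_div, ← hωw, div_self (by positivity)]
  have hMeq : ∑ i, p i • vecMulVec (v i) (v i) = A * Aᵀ := by
    ext a b
    rw [Matrix.sum_apply, Matrix.mul_apply]
    refine Finset.sum_congr rfl fun i _ => ?_
    have := hw i
    simp only [hp, hv, Matrix.smul_apply, vecMulVec_apply, smul_eq_mul, transpose_apply]
    field_simp
  have hpsd : (∑ i, p i • vecMulVec (v i) (v i)).PosSemidef := by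
    rw [hMeq]; exact posSemidef_self_mul_conjTranspose A
  have hM := hpsd.isHermitian
  have hM' : (A * Aᵀ).IsHermitian := hMeq ▸ hM
  have hev : ∀ f : ℝ → ℝ, ∑ a, f (hM'.eigenvalues a) = ∑ a, f (hM.eigenvalues a) := by
    intro f
    congr! 3
    exact hMeq.symm
  have hT : ∑ a, hM.eigenvalues a = ‖A‖ ^ 2 := by
    have := hM'.trace_eq_sum_eigenvalues
    rw [← hev fun s => s, frobenius_norm_sq_eq]
    simp only [RCLike.ofReal_real_eq_id, id] at this
    rw [← this]
    simp [Matrix.trace, Matrix.mul_apply, sq]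
  have hnorm : 0 < ‖A‖ := norm_pos_iff.2 hA
  have hsrank : srank4 A = (∑ a, hM.eigenvalues a) ^ 2 / ∑ a, hM.eigenvalues a ^ 2 := by
    rw [srank4, singularValues_sum_eq A hM' (fun s => s) (fun s => s ^ 2) rfl fun _ => rfl,
      singularValues_sum_eq A hM' (fun s => s ^ 2) (fun s => s ^ 4) (by norm_num)
        fun s => by ring, hev fun s => s, hev fun s => s ^ 2]
  have hroots : ∀ x < ε ^ 2 * ‖A‖ ^ 2,
      (gramAverage p v (⌊(1 - ε) ^ 2 * srank4 A⌋₊ + 1) []).eval x ≠ 0 := by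
    intro x hx
    rw [gramAverage_nil hpsum v hM]
    refine eval_shiftedPow_ne_zero hpsd.eigenvalues_nonneg (by rw [hT]; positivity) hε0 hε1 ?_
      (by rwa [hT])
    rw [← hsrank]
    refine Nat.floor_le (mul_nonneg (sq_nonneg _) ?_)
    rw [hsrank]
    positivity
  obtain ⟨L, hlen, hL⟩ := exists_list_gramAverage hppos v _ [] hroots
  exact ⟨L, by simpa using hlen, nodup_of_forall_eval_ne_zero v (by positivity) hL,
    le_dotProduct_transpose_mulVec _ hL⟩

theorem theorem1p3 {n m : ℕ} (A : Matrix (Fin n) (Fin m) ℝ) (hA : A ≠ 0)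
    (ε : ℝ) (hε0 : 0 < ε) (hε1 : ε < 1)
    (W : Matrix (Fin m) (Fin m) ℝ) (hWdiag : W.IsDiag) (hW : ∀ i, W i i ≠ 0) :
    ∃ S : Finset (Fin m),
      S.card = ⌊(1 - ε) ^ 2 * srank4 A⌋₊ + 1 ∧
      ε * (‖A‖ / ‖W⁻¹‖) ≤ sigmaMin (colSubmatrix A S * principalSubmatrix W S) := by
  have hm : Nonempty (Fin m) := by
    by_contra hm
    rw [not_nonempty_iff] at hm
    exact hA (by ext i j; exact hm.elim j)
  have hWinv : W⁻¹ = diagonal fun i => (W i i)⁻¹ := by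
    refine inv_eq_left_inv ?_
    have hWd : W = diagonal fun i => W i i := hWdiag.diagonal_diag.symm
    nth_rewrite 2 [hWd]
    rw [diagonal_mul_diagonal, ← diagonal_one]
    congr 1
    ext i
    exact inv_mul_cancel₀ (hW i)
  set ω := ‖W⁻¹‖ with hωdef
  have hω2 : ω ^ 2 = ∑ i, (W i i)⁻¹ ^ 2 := by
    rw [hωdef, hWinv, frobenius_norm_diagonal, EuclideanSpace.norm_sq_eq]
    simp
  have hω : 0 < ω := by
    refine lt_of_le_of_ne (norm_nonneg _) fun h => ?_
    have : 0 < ∑ i, (W i i)⁻¹ ^ 2 := Finset.sum_pos (fun i _ => by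
      have := inv_ne_zero (hW i)
      positivity) Finset.univ_nonempty
    rw [← hω2, ← h] at this
    simp at this
  obtain ⟨L, hlen, hnodup, hL⟩ := exists_list_restricted_invertibility A hA hε0 hε1 hW hω hω2
  have hcard : L.toFinset.card = ⌊(1 - ε) ^ 2 * srank4 A⌋₊ + 1 := by
    rw [List.toFinset_card_of_nodup hnodup, hlen]
  refine ⟨L.toFinset, hcard, ?_⟩
  have hne : Nonempty L.toFinset := by
    rw [Finset.nonempty_coe_sort, ← Finset.card_pos, hcard]
    exact Nat.succ_pos _
  have hsum : ∀ f : Fin m → ℝ, ∑ i : L.toFinset, f i = ∑ s : Fin L.length, f (L.get s) := by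
    intro f
    rw [Finset.sum_coe_sort L.toFinset f, List.sum_toFinset f hnodup]
    exact (Fin.sum_univ_fun_getElem L f).symm
  refine le_csInf ((NormedSpace.sphere_nonempty.2 zero_le_one).image _) ?_
  rintro _ ⟨x, hx, rfl⟩
  have hx1 : ∑ i, x i ^ 2 = 1 := by
    rw [mem_sphere_zero_iff_norm] at hx
    have := EuclideanSpace.norm_sq_eq x
    rw [hx] at this
    simpa using this.symm
  -- Extension by zero allows reindexing between `S` and positions in `L`.
  set y : Fin m → ℝ := fun i => if h : i ∈ L.toFinset then x ⟨i, h⟩ else 0 with hy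
  have hxy : ∀ i : L.toFinset, x i = y i := fun i => by
    simp only [hy]
    rw [dif_pos i.2]
  set B := colSubmatrix A L.toFinset * principalSubmatrix W L.toFinset with hB
  set c : Fin L.length → ℝ := fun s => y (L.get s) with hc
  have hcc : c ⬝ᵥ c = 1 := by
    rw [← hx1, dotProduct]
    simp only [hxy, hc, ← sq]
    exact (hsum fun i => y i ^ 2).symm
  have hBx : ∀ a, ((rowsOfList (fun i a => ω * W i i * A a i) L)ᵀ *ᵥ c) a =
      ω * (toEuclideanLin B x) a := by
    intro a
    have hBij : ∀ i : L.toFinset, B a i = A a i * W i i := by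
      intro i
      rw [hB, Matrix.mul_apply, Finset.sum_eq_single i]
      · rfl
      · intro j _ hji
        have : W j i = 0 := hWdiag fun h => hji (Subtype.ext h)
        simp [principalSubmatrix, this]
      · simp
    have h1 : (toEuclideanLin B x) a = ∑ i : L.toFinset, A a i * W i i * y i := by
      rw [toLpLin_apply]
      show ∑ i, B a i * x i = _
      exact Finset.sum_congr rfl fun i _ => by rw [hBij, ← hxy]
    rw [h1, hsum fun i => A a i * W i i * y i, Finset.mul_sum]
    show ∑ s, ω * W (L.get s) (L.get s) * A a (L.get s) * y (L.get s) = _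
    exact Finset.sum_congr rfl fun s _ => by ring
  have hnorm : ω ^ 2 * ‖toEuclideanLin B x‖ ^ 2 =
      ((rowsOfList (fun i a => ω * W i i * A a i) L)ᵀ *ᵥ c) ⬝ᵥ
        ((rowsOfList (fun i a => ω * W i i * A a i) L)ᵀ *ᵥ c) := by
    rw [EuclideanSpace.norm_sq_eq, Finset.mul_sum, dotProduct]
    refine Finset.sum_congr rfl fun a _ => ?_
    rw [hBx, Real.norm_eq_abs, sq_abs]
    ring
  have hfinal := hL c
  rw [hcc, mul_one, ← hnorm, ← mul_pow, ← mul_pow] at hfinal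
  have := le_of_sq_le_sq hfinal (by positivity)
  rw [← mul_div_assoc, div_le_iff₀ hω, mul_comm _ ω]
  exact this
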